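/- **Setting.** Let $\mathcal X\subset(0,\infty)$ be a non-empty compact set of question difficulties, let $0<\underline p<\overline p<\infty$, and let $h(x,p)\in(0,1)$, for $x\in\mathcal X$ and $p\in(\underline p,\overline p)$, be strictly decreasing in $x$, strictly increasing in $p$ and continuously differentiable in each argument. A candidate of ability $p$ answers a question $x$ correctly with probability $h(x,p)$. An algorithm asks questions $X_1,X_2,\dots\in\mathcal X$ and observes the responses $I_1,I_2,\dots\in\{0,1\}$. Write $\mathcal F_t=\sigma(X_k,I_k : k\le t)$, with $\mathcal F_0$ trivial. The (possibly randomized) rule of the algorithm fixes the conditional law of $X_{t}$ given $\mathcal F_{t-1}$ for each $t\ge 1$, and, given $\mathcal F_{t-1}$ and $X_t$, the response $I_t$ is Bernoulli with mean $h(X_t,p)$ when the ability is $p$. The algorithm stops at a stopping time $\tau$ with respect to $(\mathcal F_t)_{t\ge0}$. For $q,r\in(0,1)$ let $$d(q|r)=q\log\frac qr+(1-q)\log\frac{1-q}{1-r},$$ extended to $q,r\in[0,1]$ by the usual conventions ($0\log\frac0r=0$ for every $r\ge 0$, and $q\log\frac q0=+\infty$ for $q>0$). **Proposition.** Let $p,u\in(\underline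 p,\overline p)$ (for instance $p$ in a grade bracket $(u_i,u_{i+1})$ and $u\notin[u_i,u_{i+1})$), and let $P$ and $\tilde P$ be the laws of $(X_t,I_t)_{t\ge1}$ under one and the same algorithm when the ability of the candidate is $p$ and $u$, respectively. Suppose that $E_P(\tau)<\infty$. Then $$m_\tau(x)=E_P\Big(\sum_{t=1}^{\tau}P(X_t\le x\mid\mathcal F_{t-1})\Big),\qquad x\in\mathbb R,$$ is the expectation of an integrable random variable for each $x$, and it is a non-decreasing, right-continuous function of $x$. Moreover, $\sum_{t=1}^{\tau} d(h(X_t,p)|h(X_t,u))$ is $P$-integrable, $x\mapsto d(h(x,p)|h(x,u))$ is integrable over $\mathcal X$ with respect to the Lebesgue–Stieltjes measure $dm_\tau$, and $$E_P\Big(\sum_{t=1}^{\tau} d(h(X_t,p)|h(X_t,u))\Big)=\int_{\mathcal X} d(h(x,p)|h(x,u))\,dm_\tau(x)\ \ge\ \sup_{\mathcal E\in\mathcal F_\tau} d\big(P(\mathcal E)\,|\,\tilde P(\mathcal E)\big).$$ -/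

import Mathlib

open MeasureTheory ProbabilityTheory
open scoped ENNReal

noncomputable section

namespace AdaptiveTest

/-- The Bernoulli Kullback–Leibler divergence `d(q | r)`, for `q, r ∈ (0, 1)`. -/
def d (q r : ℝ) : ℝ :=
  q * Real.log (q / r) + (1 - q) * Real.log ((1 - q) / (1 - r))

/-- The divergence `d(q | r)` for `q, r ∈ [0, 1]`, with the usual conventions at the end points:
`0 log (0 / r) = 0` for every `r`, and `q log (q / 0) = +∞` for `q > 0`. -/
def dExt (q r : ℝ) : EReal :=
  open Classical in
  if (r = 0 ∧ q ≠ 0) ∨ (r = 1 ∧ q ≠ 1) then ⊤ else ((d q r : ℝ) : EReal)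

/-- The set `𝒳 = questions` of difficulty levels, the range `(lo, hi)` of abilities and the
response function `h`, with the standing regularity assumption on them. Nothing is asked of `h`
outside `𝒳 × (lo, hi)`. -/
structure ResponseModel where
  questions : Set ℝ
  lo : ℝ
  hi : ℝ
  h : ℝ → ℝ → ℝ
  isCompact_questions : IsCompact questions
  nonempty_questions : questions.Nonempty
  questions_pos : ∀ x ∈ questions, 0 < x
  lo_pos : 0 < lo
  lo_lt_hi : lo < hi
  h_mem : ∀ x ∈ questions, ∀ p ∈ Set.Ioo lo hi, h x p ∈ Set.Ioo (0 : ℝ) 1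
  h_strictAnti : ∀ p ∈ Set.Ioo lo hi, StrictAntiOn (fun x => h x p) questions
  h_strictMono : ∀ x ∈ questions, StrictMonoOn (fun p => h x p) (Set.Ioo lo hi)
  h_contDiff_left : ∀ p ∈ Set.Ioo lo hi, ContDiffOn ℝ 1 (fun x => h x p) questions
  h_contDiff_right : ∀ x ∈ questions, ContDiffOn ℝ 1 (fun p => h x p) (Set.Ioo lo hi)

namespace ResponseModel

variable (M : ResponseModel)

/-- The possible abilities of a candidate. -/
abbrev Ability : Type := Set.Ioo M.lo M.hi

/-- A question together with the response to it (`true` is a correct answer). -/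
abbrev Obs : Type := M.questions × Bool

/-- Infinite records of questions and responses: `ω k = (X_{k+1}, I_{k+1})`. -/
abbrev Record : Type := ℕ → M.Obs

/-- The law of the response of a candidate of ability `p` to the question `x`: Bernoulli with
success probability `h x p`. -/
def response (p : M.Ability) : Kernel M.questions Bool where
  toFun x := bernoulliMeasure true false
    ⟨M.h x p, (M.h_mem x x.2 p p.2).1.le, (M.h_mem x x.2 p p.2).2.le⟩
  measurable' := by
    have hc : Measurable (fun x : M.questions => M.h x p) :=
      (continuousOn_iff_continuous_domRestrict.mp
        (M.h_contDiff_left p p.2).continuousOn).measurable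
    refine Measure.measurable_of_measurable_coe _ fun s hs => ?_
    classical
    simp only [bernoulliMeasure_apply _ hs]
    have h1 : Measurable (fun x : M.questions => (⟨M.h x p, (M.h_mem x x.2 p p.2).1.le,
        (M.h_mem x x.2 p p.2).2.le⟩ : unitInterval)) := hc.subtype_mk
    have h2 : Measurable (unitInterval.toNNReal) := by
      apply Continuous.measurable; fun_prop
    have h3 : Measurable (unitInterval.symm) := by
      apply Continuous.measurable; fun_prop
    split_ifs
    · exact measurable_const
    · exact measurable_coe_nnreal_ennreal.comp (h2.comp h1)
    · exact measurable_coe_nnreal_ennreal.comp (h2.comp (h3.comp h1))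
    · exact measurable_const

instance (p : M.Ability) : IsMarkovKernel (M.response p) :=
  ⟨fun _ => inferInstanceAs (IsProbabilityMeasure (bernoulliMeasure true false _))⟩

/-- The question asked at stage `k + 1`. -/
def question (k : ℕ) (ω : M.Record) : ℝ := (ω k).1

/-- `M.history t` is the `σ`-algebra `ℱ_t` generated by the first `t` questions and responses. -/
def history : Filtration ℕ (inferInstance : MeasurableSpace M.Record) where
  seq t := ⨆ k : ℕ, ⨆ _ : k < t, MeasurableSpace.comap (fun ω : M.Record => ω k) inferInstance
  mono' _ _ hst := iSup₂_le fun k hk =>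
    le_iSup₂_of_le (f := fun k _ => MeasurableSpace.comap (fun ω : M.Record => ω k) inferInstance)
      k (hk.trans_le hst) le_rfl
  le' _ := iSup₂_le fun k _ => (measurable_pi_apply k).comap_le

end ResponseModel

/-- A (possibly randomized) adaptive questioning rule: the law of the first question, and the
law of each later question as a function of all the previous questions and responses. -/
structure QuestionRule (M : ResponseModel) where
  first : Measure M.questions
  next : (n : ℕ) → Kernel ((i : Finset.Iic n) → (fun _ : ℕ => M.Obs) i) M.questions
  isProbabilityMeasure_first : IsProbabilityMeasure first
  isMarkovKernel_next : ∀ n, IsMarkovKernel (next n)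

namespace QuestionRule

variable {M : ResponseModel} (A : QuestionRule M)

instance : IsProbabilityMeasure A.first := A.isProbabilityMeasure_first

instance (n : ℕ) : IsMarkovKernel (A.next n) := A.isMarkovKernel_next n

/-- The conditional law of the `(n + 2)`-nd question and its response given the past. -/
def step (p : M.Ability) (n : ℕ) :
    Kernel ((i : Finset.Iic n) → (fun _ : ℕ => M.Obs) i) M.Obs :=
  A.next n ⊗ₖ (M.response p).comap Prod.snd measurable_snd

instance (p : M.Ability) (n : ℕ) : IsMarkovKernel (A.step p n) := by
  unfold step; infer_instance

/-- The law of the record when the rule `A` faces a candidate of ability `p`. -/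
def law (p : M.Ability) : Measure M.Record :=
  Kernel.trajMeasure (X := fun _ : ℕ => M.Obs) (A.first ⊗ₘ M.response p) (A.step p)

instance (p : M.Ability) : IsProbabilityMeasure (A.law p) := by
  unfold law; infer_instance

/-- The random variable `∑_{t=1}^τ P(X_t ≤ x | ℱ_{t-1})`, for a candidate of ability `p`. -/
def condSampling (p : M.Ability) (τ : M.Record → ℕ∞) (x : ℝ) (ω : M.Record) : ℝ :=
  ∑ k ∈ Finset.range (τ ω).toNat,
    ((A.law p)⟦{ω' | M.question k ω' ≤ x} | M.history k⟧) ω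

/-- The expected conditional-sampling distribution function `m_τ`. -/
def samplingDF (p : M.Ability) (τ : M.Record → ℕ∞) (x : ℝ) : ℝ :=
  ∫ ω, A.condSampling p τ x ω ∂(A.law p)

end QuestionRule

end AdaptiveTest

end

/-!
Let `ℓ` (`ResponseModel.logLik`) be the log-likelihood ratio of the abilities `p` and `u` carried by
one observation, and `N = τ.toNat`, which is `τ` almost surely under the law `P` at ability `p`.
Questions are indexed from `0`, so those asked up to `τ` are the `Xₖ` with `k < τ`.

*Equality.* The event `k < τ` is known before the question of index `k` is asked. Hence
`m_τ(x) = ∑ₖ P(k < τ, Xₖ ≤ x)`: on `k < τ` the conditional probability may be replaced by the event.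
So `m_τ` is the distribution function of the finite measure `QuestionRule.occupation`, the expected
number of questions in a given set that are asked up to `τ`, whose total mass is `E_P τ`. The
integral of the divergence against it is the expected sum of divergences up to `τ`. The sums of
random length are handled by `hasSum_setIntegral_sum_range`: their terms are bounded, `𝒳` being
compact.

*Inequality.* Given the history and the question, the mean of `ℓ` at ability `p` is the divergence
of the two response laws (`QuestionRule.setIntegral_logLik`), so the expected sum of divergences is
`E_P L` with `L = ∑_{k < N} ℓ(Xₖ, Iₖ)`. The rule is the same at both abilities, so up to time `n`
the law at ability `u` has density `exp (-∑_{k < n} ℓ)` with respect to `P`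
(`QuestionRule.lintegral_law_change`). Summing over the values of `τ` gives
`E_P[exp (-L); E] ≤ P̃(E)` for every `E` in the `σ`-algebra of `τ`; the missing part is
`P̃(E, τ = ∞)`, which need not vanish. Jensen's inequality on `E` and on its complement turns this
into `d(P(E) | P̃(E)) ≤ E_P L` (`dExt_le_integral`), including the cases in which `P̃(E)` is `0` or
`1`: the bound then forces `P(E) = P̃(E)`.
-/

namespace AdaptiveTest

/-! ### Sums of random length -/

section Wald

variable {Ω : Type*} [MeasurableSpace Ω] {μ : Measure Ω} {N : Ω → ℕ} {Y : ℕ → Ω → ℝ} {C : ℝ}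

lemma sum_range_eq_tsum_indicator {Ω : Type*} (N : Ω → ℕ) (Y : ℕ → Ω → ℝ) (ω : Ω) :
    ∑ k ∈ Finset.range (N ω), Y k ω = ∑' k, {ω | k < N ω}.indicator (Y k) ω := by
  rw [tsum_eq_sum (s := Finset.range (N ω))]
  · refine Finset.sum_congr rfl fun k hk => ?_
    rw [Set.indicator_of_mem]
    simpa using hk
  · intro k hk
    rw [Set.indicator_of_notMem]
    simpa using hk

lemma tsum_measure_lt (hN : Measurable N) :
    ∑' k, μ {ω | k < N ω} = ∫⁻ ω, (N ω : ℝ≥0∞) ∂μ := by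
  have hs (k : ℕ) : MeasurableSet {ω | k < N ω} := measurableSet_lt measurable_const hN
  simp_rw [← fun k => lintegral_indicator_one (μ := μ) (hs k)]
  rw [← lintegral_tsum fun k => (measurable_one.indicator (hs k)).aemeasurable]
  congr with ω
  rw [tsum_eq_sum (s := Finset.range (N ω))]
  · rw [Finset.sum_congr rfl (g := fun _ => 1) fun k hk => ?_]
    · simp
    · rw [Set.indicator_of_mem]
      · rfl
      · simpa using hk
  · intro k hk
    rw [Set.indicator_of_notMem]
    simpa using hk

lemma aestronglyMeasurable_sum_range (hN : Measurable N)
    (hY : ∀ k, AEStronglyMeasurable (Y k) μ) :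
    AEStronglyMeasurable (fun ω => ∑ k ∈ Finset.range (N ω), Y k ω) μ := by
  have hG : Measurable fun ω => ∑ k ∈ Finset.range (N ω), (hY k).mk _ ω := by
    simp_rw [fun ω => sum_range_eq_tsum_indicator N (fun k => (hY k).mk _) ω]
    have : (fun ω => ∑' k, {ω | k < N ω}.indicator ((hY k).mk _) ω)
        = fun ω => (fun q : ℕ × Ω => ∑ k ∈ Finset.range q.1, (hY k).mk _ q.2) (N ω, ω) := by
      ext ω
      rw [← sum_range_eq_tsum_indicator]
    rw [this]
    refine Measurable.comp (g := fun q : ℕ × Ω => ∑ k ∈ Finset.range q.1, (hY k).mk _ q.2)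
      (measurable_from_prod_countable_right fun n => ?_) (hN.prodMk measurable_id)
    exact Finset.measurable_sum (Finset.range n) fun k _ =>
      (hY k).stronglyMeasurable_mk.measurable
  refine hG.aestronglyMeasurable.congr ?_
  filter_upwards [ae_all_iff.2 fun k => (hY k).ae_eq_mk] with ω hω
  exact Finset.sum_congr rfl fun k _ => (hω k).symm

lemma integrable_natCast (hN : Measurable N) (hfin : ∫⁻ ω, (N ω : ℝ≥0∞) ∂μ < ∞) :
    Integrable (fun ω => (N ω : ℝ)) μ := by
  refine ⟨(measurable_from_nat.comp hN).aestronglyMeasurable, ?_⟩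
  rw [hasFiniteIntegral_iff_enorm]
  convert hfin with ω
  simp

/-- A sum of uniformly bounded variables, of random length with finite mean, is integrable. -/
lemma integrable_sum_range (hN : Measurable N) (hfin : ∫⁻ ω, (N ω : ℝ≥0∞) ∂μ < ∞)
    (hY : ∀ k, AEStronglyMeasurable (Y k) μ) (hC : ∀ k, ∀ᵐ ω ∂μ, |Y k ω| ≤ C) :
    Integrable (fun ω => ∑ k ∈ Finset.range (N ω), Y k ω) μ := by
  refine ((integrable_natCast hN hfin).mul_const C).mono' (aestronglyMeasurable_sum_range hN hY) ?_
  filter_upwards [ae_all_iff.2 hC] with ω hω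
  calc ‖∑ k ∈ Finset.range (N ω), Y k ω‖ ≤ ∑ k ∈ Finset.range (N ω), C :=
        norm_sum_le_of_le _ fun k _ => hω k
    _ = N ω * C := by simp

/-- The expectation of a sum of random length is the sum of the expectations of its terms, each
restricted to the event that the term is present. -/
lemma hasSum_setIntegral_sum_range [IsFiniteMeasure μ] (hN : Measurable N)
    (hfin : ∫⁻ ω, (N ω : ℝ≥0∞) ∂μ < ∞)
    (hY : ∀ k, AEStronglyMeasurable (Y k) μ) (hC : ∀ k, ∀ᵐ ω ∂μ, |Y k ω| ≤ C) :
    HasSum (fun k => ∫ ω in {ω | k < N ω}, Y k ω ∂μ)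
      (∫ ω, ∑ k ∈ Finset.range (N ω), Y k ω ∂μ) := by
  have hs (k : ℕ) : MeasurableSet {ω | k < N ω} := measurableSet_lt measurable_const hN
  have hint (k : ℕ) : Integrable (Y k) μ := Integrable.of_bound (hY k) C (hC k)
  have hsum : Summable fun k => C * μ.real {ω | k < N ω} := by
    refine Summable.mul_left _ (ENNReal.summable_toReal ?_)
    rw [tsum_measure_lt hN]
    exact hfin.ne
  simp_rw [sum_range_eq_tsum_indicator N Y,
    ← fun k => integral_indicator (μ := μ) (f := Y k) (hs k)]
  refine hasSum_integral_of_summable_integral_norm (fun k => (hint k).indicator (hs k))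
    (hsum.of_nonneg_of_le (fun k => integral_nonneg fun _ => norm_nonneg _) fun k => ?_)
  simp_rw [norm_indicator_eq_indicator_norm]
  rw [integral_indicator (hs k)]
  calc ∫ ω in {ω | k < N ω}, ‖Y k ω‖ ∂μ ≤ ∫ ω in {ω | k < N ω}, C ∂μ :=
        integral_mono_ae (hint k).norm.integrableOn (integrable_const _)
          (ae_restrict_of_ae (hC k))
    _ = C * μ.real {ω | k < N ω} := by simp [mul_comm]

end Wald

/-! ### Distribution functions of finite measures -/

section Stieltjes

/-- A finite measure on the line is the Lebesgue–Stieltjes measure of its distribution function. -/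
lemma exists_stieltjesFunction_measure_eq (ν : Measure ℝ) [IsFiniteMeasure ν] :
    ∃ m : StieltjesFunction ℝ, (∀ x, m x = ν.real (Set.Iic x)) ∧ m.measure = ν := by
  rcases eq_or_ne ν 0 with rfl | h0
  · exact ⟨0, by simp, by simp⟩
  have : NeZero ν := ⟨h0⟩
  set c := (ν Set.univ).toNNReal
  have hc : (c : ℝ≥0∞) = ν Set.univ := ENNReal.coe_toNNReal (measure_ne_top _ _)
  have hu : ν Set.univ ≠ 0 := by simpa using h0
  have hmeas : (c : ℝ≥0∞) • ((ν Set.univ)⁻¹ • ν) = ν := by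
    rw [smul_smul, hc, ENNReal.mul_inv_cancel hu (measure_ne_top _ _), one_smul]
  refine ⟨c • cdf ((ν Set.univ)⁻¹ • ν), fun x => ?_, ?_⟩
  · conv_rhs => rw [← hmeas]
    rw [measureReal_ennreal_smul_apply, ← cdf_eq_real]
    rfl
  · rw [StieltjesFunction.measure_smul, measure_cdf]
    exact hmeas

end Stieltjes

/-! ### Divergence of two events -/

section DataProcessing

variable {Ω : Type*} [MeasurableSpace Ω] {P Q : Measure Ω} {L : Ω → ℝ} {E : Set Ω}

/-- If `exp (-L)` is a (sub-)density of `Q` with respect to `P` on `E`, an event of positive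
`P`-probability has positive `Q`-probability. -/
lemma measure_eq_zero_of_lintegral_exp_neg_le (hL : Integrable L P)
    (hQ : ∫⁻ ω in E, ENNReal.ofReal (Real.exp (-L ω)) ∂P ≤ Q E) (h0 : Q E = 0) : P E = 0 := by
  have h1 : ∫⁻ ω in E, ENNReal.ofReal (Real.exp (-L ω)) ∂P = 0 :=
    le_antisymm (hQ.trans h0.le) bot_le
  rw [lintegral_eq_zero_iff' (by
    exact (Real.measurable_exp.comp_aemeasurable
      hL.aemeasurable.neg.restrict).ennreal_ofReal)] at h1
  rw [← Measure.restrict_eq_zero, ← ae_eq_bot, ← Filter.eventually_false_iff_eq_bot]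
  filter_upwards [h1] with ω hω
  exact (ENNReal.ofReal_pos.2 (Real.exp_pos (-L ω))).ne' hω

/-- The log-sum inequality on an event `E`: it is Jensen's inequality for `exp (-L)` on `E`, in the
tangent-line form `log y ≤ y - 1`. -/
lemma real_mul_log_le_setIntegral [IsFiniteMeasure P] [IsFiniteMeasure Q] (hL : Integrable L P)
    (hQ : ∫⁻ ω in E, ENNReal.ofReal (Real.exp (-L ω)) ∂P ≤ Q E) :
    P.real E * Real.log (P.real E / Q.real E) ≤ ∫ ω in E, L ω ∂P := by
  rcases eq_or_ne (P E) 0 with hP | hP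
  · simp [measureReal_def, hP, Measure.restrict_eq_zero.2 hP]
  have hQE : Q E ≠ 0 := fun h => hP (measure_eq_zero_of_lintegral_exp_neg_le hL hQ h)
  have hp : 0 < P.real E := ENNReal.toReal_pos hP (measure_ne_top _ _)
  have hq : 0 < Q.real E := ENNReal.toReal_pos hQE (measure_ne_top _ _)
  have hmeas : AEStronglyMeasurable (fun ω => Real.exp (-L ω)) (P.restrict E) :=
    (Real.measurable_exp.comp_aemeasurable hL.aemeasurable.neg.restrict).aestronglyMeasurable
  have hexp : Integrable (fun ω => Real.exp (-L ω)) (P.restrict E) := by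
    refine ⟨hmeas, ?_⟩
    rw [hasFiniteIntegral_iff_ofReal (ae_of_all _ fun ω => (Real.exp_pos _).le)]
    exact hQ.trans_lt (measure_lt_top _ _)
  have hexp_le : ∫ ω in E, Real.exp (-L ω) ∂P ≤ Q.real E := by
    rw [integral_eq_lintegral_of_nonneg_ae (ae_of_all _ fun ω => (Real.exp_pos _).le) hmeas]
    exact ENNReal.toReal_mono (measure_ne_top _ _) hQ
  -- The tangent point is the mean value of `exp (-L)` on `E` in the extremal case.
  set a := Q.real E / P.real E
  have ha : 0 < a := div_pos hq hp
  have hpt (ω : Ω) : 1 - Real.log a - a⁻¹ * Real.exp (-L ω) ≤ L ω := by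
    have := Real.log_le_sub_one_of_pos (mul_pos (inv_pos.2 ha) (Real.exp_pos (-L ω)))
    rw [Real.log_mul (inv_pos.2 ha).ne' (Real.exp_pos _).ne', Real.log_exp, Real.log_inv] at this
    linarith
  have hi : Integrable (fun ω => 1 - Real.log a - a⁻¹ * Real.exp (-L ω)) (P.restrict E) :=
    (integrable_const _).sub (hexp.const_mul _)
  calc P.real E * Real.log (P.real E / Q.real E)
      = P.real E * (1 - Real.log a) - a⁻¹ * Q.real E := by
        have : P.real E / Q.real E = a⁻¹ := by simp [a]
        rw [this, Real.log_inv]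
        simp only [a, inv_div]
        field_simp
        ring
    _ ≤ P.real E * (1 - Real.log a) - a⁻¹ * ∫ ω in E, Real.exp (-L ω) ∂P := by gcongr
    _ = ∫ ω in E, (1 - Real.log a - a⁻¹ * Real.exp (-L ω)) ∂P := by
        rw [integral_sub (integrable_const _) (hexp.const_mul _), integral_const_mul]
        simp
    _ ≤ ∫ ω in E, L ω ∂P := integral_mono hi hL.integrableOn hpt

/-- Data processing for the two-set partition `{E, Eᶜ}`: the divergence of the probabilities of `E`
is at most the expected log-likelihood ratio. -/
lemma dExt_le_integral [IsProbabilityMeasure P] [IsProbabilityMeasure Q] (hL : Integrable L P)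
    (hE : MeasurableSet E)
    (hQ : ∫⁻ ω in E, ENNReal.ofReal (Real.exp (-L ω)) ∂P ≤ Q E)
    (hQc : ∫⁻ ω in Eᶜ, ENNReal.ofReal (Real.exp (-L ω)) ∂P ≤ Q Eᶜ) :
    dExt (P.real E) (Q.real E) ≤ ((∫ ω, L ω ∂P : ℝ) : EReal) := by
  have hPc : P.real Eᶜ = 1 - P.real E := probReal_compl_eq_one_sub hE
  have hQc' : Q.real Eᶜ = 1 - Q.real E := probReal_compl_eq_one_sub hE
  unfold dExt
  rw [if_neg]
  · rw [EReal.coe_le_coe_iff, d, ← integral_add_compl hE hL, ← hPc, ← hQc']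
    exact add_le_add (real_mul_log_le_setIntegral hL hQ) (real_mul_log_le_setIntegral hL hQc)
  · rintro (⟨h0, h1⟩ | ⟨h0, h1⟩)
    · rw [measureReal_eq_zero_iff] at h0
      exact h1 (by simp [measureReal_def, measure_eq_zero_of_lintegral_exp_neg_le hL hQ h0])
    · have h2 : Q Eᶜ = 0 := by
        rw [← measureReal_eq_zero_iff, hQc', h0, sub_self]
      have h3 : P.real Eᶜ = 0 := by
        simp [measureReal_def, measure_eq_zero_of_lintegral_exp_neg_le hL hQc h2]
      exact h1 (by linarith)

end DataProcessing

/-! ### Responses and the log-likelihood ratio -/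

namespace ResponseModel

variable (M : ResponseModel)

lemma history_zero : M.history 0 = ⊥ := by
  change (⨆ k : ℕ, ⨆ _ : k < 0, _) = _
  simp

lemma history_succ (n : ℕ) : M.history (n + 1) =
    M.history n ⊔ MeasurableSpace.comap (fun ω : M.Record => ω n) inferInstance :=
  Nat.iSup_lt_succ (fun k => MeasurableSpace.comap (fun ω : M.Record => ω k) inferInstance) n

lemma history_succ_le_comap_frestrictLe (n : ℕ) : M.history (n + 1) ≤
    MeasurableSpace.comap (Preorder.frestrictLe (π := fun _ : ℕ => M.Obs) n) inferInstance := by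
  refine iSup₂_le fun k hk => Measurable.comap_le ?_
  exact (measurable_pi_apply (⟨k, Finset.mem_Iic.2 (Nat.lt_succ_iff.1 hk)⟩ : Finset.Iic n)).comp
    (comap_measurable (Preorder.frestrictLe (π := fun _ : ℕ => M.Obs) n))

lemma measurable_eval {k n : ℕ} (h : k < n) : Measurable[M.history n] fun ω : M.Record => ω k :=
  Measurable.of_comap_le (le_iSup₂_of_le (f := fun k _ =>
    MeasurableSpace.comap (fun ω : M.Record => ω k) inferInstance) k h le_rfl)

variable {M}

lemma response_apply (p : M.Ability) (x : M.questions) : M.response p x =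
    bernoulliMeasure true false ⟨M.h x p, (M.h_mem x x.2 p p.2).1.le, (M.h_mem x x.2 p p.2).2.le⟩ :=
  rfl

lemma integral_response (p : M.Ability) (x : M.questions) (f : Bool → ℝ) :
    ∫ i, f i ∂M.response p x = M.h x p * f true + (1 - M.h x p) * f false := by
  rw [response_apply, integral_bernoulliMeasure]
  simp

lemma lintegral_response (p : M.Ability) (x : M.questions) (f : Bool → ℝ≥0∞) :
    ∫⁻ i, f i ∂M.response p x =
      ENNReal.ofReal (M.h x p) * f true + ENNReal.ofReal (1 - M.h x p) * f false := by
  have h := M.h_mem x x.2 p p.2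
  rw [response_apply, bernoulliMeasure_def, lintegral_add_measure]
  simp only [lintegral_smul_measure, lintegral_dirac]
  congr 1
  · rw [ENNReal.ofReal, Real.toNNReal_of_nonneg h.1.le]; rfl
  · rw [ENNReal.ofReal, Real.toNNReal_of_nonneg (sub_nonneg.2 h.2.le)]; rfl

lemma continuous_h (p : M.Ability) : Continuous fun x : M.questions => M.h x p :=
  continuousOn_iff_continuous_domRestrict.mp (M.h_contDiff_left p p.2).continuousOn

/-- The log-likelihood ratio of the abilities `p` and `u` carried by a single observation. -/
noncomputable def logLik (p u : M.Ability) (o : M.Obs) : ℝ :=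
  if o.2 then Real.log (M.h o.1 p / M.h o.1 u)
  else Real.log ((1 - M.h o.1 p) / (1 - M.h o.1 u))

lemma continuous_logLik (p u : M.Ability) : Continuous (logLik p u) := by
  have key (i : Bool) : Continuous fun x : M.questions => logLik p u (x, i) := by
    have hu (x : M.questions) := M.h_mem x x.2 u u.2
    have hp (x : M.questions) := M.h_mem x x.2 p p.2
    cases i
    · exact ((continuous_const.sub (continuous_h p)).div (continuous_const.sub (continuous_h u))
        fun x => (sub_pos.2 (hu x).2).ne').log
          fun x => (div_pos (sub_pos.2 (hp x).2) (sub_pos.2 (hu x).2)).ne'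
    · exact ((continuous_h p).div (continuous_h u) fun x => (hu x).1.ne').log
        fun x => (div_pos (hp x).1 (hu x).1).ne'
  exact continuous_prod_of_discrete_right.2 key

lemma measurable_logLik (p u : M.Ability) : Measurable (logLik p u) :=
  (continuous_logLik p u).measurable

lemma exists_abs_logLik_le (p u : M.Ability) : ∃ C, ∀ o, |logLik p u o| ≤ C := by
  have : CompactSpace M.questions := isCompact_iff_compactSpace.1 M.isCompact_questions
  obtain ⟨C, hC⟩ := isCompact_univ.exists_bound_of_continuousOn (continuous_logLik p u).continuousOn
  exact ⟨C, fun o => hC o trivial⟩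

lemma integral_logLik (p u : M.Ability) (x : M.questions) :
    ∫ i, logLik p u (x, i) ∂M.response p x = d (M.h x p) (M.h x u) := by
  rw [integral_response]
  simp [logLik, d]

/-- The response law at ability `u` has density `exp (-logLik p u)` with respect to the response
law at ability `p`. -/
lemma lintegral_response_change (p u : M.Ability) (x : M.questions) (f : Bool → ℝ≥0∞) :
    ∫⁻ i, f i ∂M.response u x =
      ∫⁻ i, ENNReal.ofReal (Real.exp (-logLik p u (x, i))) * f i ∂M.response p x := by
  have hu := M.h_mem x x.2 u u.2
  have hp := M.h_mem x x.2 p p.2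
  have hu' := sub_pos.2 hu.2
  have hp' := sub_pos.2 hp.2
  rw [lintegral_response, lintegral_response, ← mul_assoc, ← mul_assoc,
    ← ENNReal.ofReal_mul hp.1.le, ← ENNReal.ofReal_mul hp'.le]
  simp only [logLik, if_true, Bool.false_eq_true, if_false, Real.exp_neg]
  rw [Real.exp_log (div_pos hp.1 hu.1), Real.exp_log (div_pos hp' hu')]
  congr 3
  · field_simp [hp.1.ne']
  · field_simp [hp'.ne']

lemma exists_abs_d_le (p u : M.Ability) : ∃ C, ∀ x : M.questions, |d (M.h x p) (M.h x u)| ≤ C := by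
  obtain ⟨C, hC⟩ := exists_abs_logLik_le p u
  refine ⟨C, fun x => ?_⟩
  rw [← integral_logLik]
  exact (norm_integral_le_of_norm_le_const (μ := M.response p x)
    (f := fun i => logLik p u (x, i)) (ae_of_all _ fun i => hC (x, i))).trans_eq
      (by rw [probReal_univ, mul_one])

lemma measurable_d (p u : M.Ability) :
    Measurable fun x : M.questions => d (M.h x p) (M.h x u) := by
  simp_rw [← integral_logLik]
  exact ((measurable_logLik p u).stronglyMeasurable.integral_kernel_prod_right'
    (κ := M.response p)).measurable

lemma measurable_eval_fst (k : ℕ) : Measurable fun ω : M.Record => (ω k).1 :=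
  measurable_fst.comp (measurable_pi_apply k)

end ResponseModel

/-! ### The law of one step -/

namespace QuestionRule

open ResponseModel

variable {M : ResponseModel} (A : QuestionRule M)

/-- The conditional law of the question of index `k` given the history before it. It depends on the
rule only, not on the ability of the candidate. -/
noncomputable def nextQuestion : ℕ → M.Record → Measure M.questions
  | 0, _ => A.first
  | n + 1, ω => A.next n (Preorder.frestrictLe n ω)

lemma map_eval_zero_law (p : M.Ability) :
    (A.law p).map (fun ω => ω 0) = A.first ⊗ₘ M.response p := by
  have h : (A.law p).map (Preorder.frestrictLe (π := fun _ : ℕ => M.Obs) 0) =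
      (A.first ⊗ₘ M.response p).map
        (MeasurableEquiv.piUnique fun _ : Finset.Iic 0 => M.Obs).symm := by
    rw [law, Kernel.trajMeasure, Measure.map_comp _ _ (by fun_prop), Kernel.traj_map_frestrictLe,
      Kernel.partialTraj_self, Measure.id_comp]
  have h2 : (fun ω : M.Record => ω 0) = (fun y : (Finset.Iic 0 → M.Obs) =>
      y ⟨0, Finset.mem_Iic.2 le_rfl⟩) ∘ Preorder.frestrictLe (π := fun _ : ℕ => M.Obs) 0 := rfl
  rw [h2, ← Measure.map_map (by fun_prop) (by fun_prop), h,
    Measure.map_map (by fun_prop) (by fun_prop)]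
  exact Measure.map_id

lemma measurable_lintegral_response (p : M.Ability) {φ : M.Obs → ℝ≥0∞} (hφ : Measurable φ) :
    Measurable fun x => ∫⁻ i, φ (x, i) ∂M.response p x :=
  Measurable.lintegral_kernel_prod_right hφ

lemma measurable_lintegral_nextQuestion (k : ℕ) {ψ : M.questions → ℝ≥0∞} (hψ : Measurable ψ) :
    Measurable[M.history k] fun ω => ∫⁻ x, ψ x ∂A.nextQuestion k ω := by
  cases k with
  | zero =>
    simp only [nextQuestion]
    exact measurable_const
  | succ n =>
    have h : Measurable fun y => ∫⁻ x, ψ x ∂A.next n y := hψ.lintegral_kernel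
    have hf : Measurable[M.history (n + 1)]
        (Preorder.frestrictLe (π := fun _ : ℕ => M.Obs) n) :=
      @measurable_pi_lambda _ _ _ (M.history (n + 1)) _ _ fun i =>
        M.measurable_eval (Nat.lt_succ_iff.2 (Finset.mem_Iic.1 i.2))
    exact h.comp hf

/-- The one-step law: given the history, the question of index `k` is drawn from `nextQuestion`, and
the response to it from the response kernel. -/
lemma lintegral_mul_eval (p : M.Ability) (k : ℕ) {f : M.Record → ℝ≥0∞}
    (hf : Measurable[M.history k] f) {φ : M.Obs → ℝ≥0∞} (hφ : Measurable φ) :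
    ∫⁻ ω, f ω * φ (ω k) ∂A.law p =
      ∫⁻ ω, f ω * ∫⁻ x, ∫⁻ i, φ (x, i) ∂M.response p x ∂A.nextQuestion k ω ∂A.law p := by
  cases k with
  | zero =>
    rw [history_zero] at hf
    obtain ⟨c, rfl⟩ := eq_const_of_measurable_bot hf
    have h0 : ∫⁻ ω, φ (ω 0) ∂A.law p = ∫⁻ x, ∫⁻ i, φ (x, i) ∂M.response p x ∂A.first := by
      rw [← Measure.lintegral_compProd hφ, ← map_eval_zero_law, lintegral_map hφ (by fun_prop)]
    rw [lintegral_const_mul _ (by fun_prop), h0]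
    simp [nextQuestion]
  | succ n =>
    obtain ⟨g, hg, rfl⟩ := (hf.mono (M.history_succ_le_comap_frestrictLe n)
      le_rfl).exists_eq_measurable_comp
    have h1 := Kernel.map_frestrictLe_trajMeasure_compProd_eq_map_trajMeasure
      (X := fun _ : ℕ => M.Obs) (μ₀ := A.first ⊗ₘ M.response p) (κ := A.step p) (a := n)
    have h2 : Measurable fun q : (Finset.Iic n → M.Obs) × M.Obs => g q.1 * φ q.2 := by fun_prop
    have h3 := lintegral_map (μ := A.law p) h2
      (g := fun ω : M.Record => (Preorder.frestrictLe (π := fun _ : ℕ => M.Obs) n ω, ω (n + 1)))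
      (by fun_prop)
    refine h3.symm.trans ?_
    rw [law, ← h1, Measure.lintegral_compProd h2, lintegral_map _ (by fun_prop)]
    · refine lintegral_congr fun ω => ?_
      dsimp only [Function.comp_apply]
      rw [lintegral_const_mul _ hφ, step, Kernel.lintegral_compProd _ _ _ hφ]
      rfl
    · exact h2.lintegral_kernel_prod_right

end QuestionRule

/-! ### Measures on a join of two `σ`-algebras -/

section Uniqueness

/-- Measures which agree on the intersections `X ⁻¹' S ∩ Y ⁻¹' T` agree on `σ(X, Y)`. -/
lemma measure_eq_of_forall_inter {Ω α β : Type*} {mΩ : MeasurableSpace Ω} {mα : MeasurableSpace α}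
    {mβ : MeasurableSpace β} {μ ν : Measure Ω} [IsFiniteMeasure μ] {X : Ω → α} {Y : Ω → β}
    (hX : Measurable X) (hY : Measurable Y)
    (h : ∀ S T, MeasurableSet S → MeasurableSet T →
      μ (X ⁻¹' S ∩ Y ⁻¹' T) = ν (X ⁻¹' S ∩ Y ⁻¹' T))
    {E : Set Ω} (hE : MeasurableSet[mα.comap X ⊔ mβ.comap Y] E) : μ E = ν E := by
  have hν : IsFiniteMeasure ν := ⟨by
    have := h Set.univ Set.univ .univ .univ
    simp only [Set.preimage_univ, Set.inter_univ] at this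
    exact this ▸ measure_lt_top μ _⟩
  rw [← MeasurableSpace.comap_prodMk] at hE
  obtain ⟨F, hF, rfl⟩ := hE
  have hXY := hX.prodMk hY
  have key : μ.map (fun ω => (X ω, Y ω)) = ν.map (fun ω => (X ω, Y ω)) := by
    refine Measure.ext_prod fun {S T} hS hT => ?_
    rw [Measure.map_apply hXY (hS.prod hT), Measure.map_apply hXY (hS.prod hT)]
    exact h S T hS hT
  rw [← Measure.map_apply hXY hF, key, Measure.map_apply hXY hF]

lemma measurable_indicator_one {Ω : Type*} {m : MeasurableSpace Ω} {S : Set Ω}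
    (hS : MeasurableSet S) : Measurable (S.indicator (1 : Ω → ℝ≥0∞)) :=
  measurable_one.indicator hS

end Uniqueness

/-! ### Conditional response law and change of measure -/

namespace QuestionRule

open ResponseModel

variable {M : ResponseModel} (A : QuestionRule M)

/-- Given the history, the response to the question of index `k` follows the response kernel. -/
lemma map_eval_restrict_law (p : M.Ability) (k : ℕ) {S : Set M.Record}
    (hS : MeasurableSet[M.history k] S) :
    ((A.law p).restrict S).map (fun ω => ω k) =
      (((A.law p).restrict S).map fun ω => (ω k).1) ⊗ₘ M.response p := by
  have hS' := M.history.le k _ hS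
  have hind : Measurable[M.history k] (S.indicator (1 : M.Record → ℝ≥0∞)) :=
    measurable_indicator_one hS
  have hset (φ : M.Record → ℝ≥0∞) :
      ∫⁻ ω in S, φ ω ∂A.law p = ∫⁻ ω, S.indicator 1 ω * φ ω ∂A.law p := by
    rw [← lintegral_indicator hS']
    congr with ω
    by_cases h : ω ∈ S <;> simp [h]
  ext T hT
  have hφ : Measurable (T.indicator (1 : M.Obs → ℝ≥0∞)) := measurable_one.indicator hT
  have hψ := measurable_lintegral_response p hφ
  have hfst : Measurable fun ω : M.Record => (ω k).1 := measurable_fst.comp (measurable_pi_apply k)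
  rw [← lintegral_indicator_one hT, ← lintegral_indicator_one hT,
    lintegral_map hφ (measurable_pi_apply k), Measure.lintegral_compProd hφ,
    lintegral_map hψ hfst, hset, hset,
    A.lintegral_mul_eval p k hind hφ,
    A.lintegral_mul_eval p k hind (φ := fun o => ∫⁻ i, T.indicator 1 (o.1, i) ∂M.response p o.1)
      (hψ.comp measurable_fst)]
  simp only [lintegral_const, measure_univ, mul_one]

/-- On an event known before the question of index `k`, the expected log-likelihood ratio of the
observation of index `k` is the expected divergence of the two response laws. -/
lemma setIntegral_logLik (p u : M.Ability) (k : ℕ) {S : Set M.Record}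
    (hS : MeasurableSet[M.history k] S) :
    ∫ ω in S, logLik p u (ω k) ∂A.law p =
      ∫ ω in S, d (M.h (M.question k ω) p) (M.h (M.question k ω) u) ∂A.law p := by
  obtain ⟨C, hC⟩ := exists_abs_logLik_le p u
  have hm := measurable_logLik p u
  have hfst : Measurable fun ω : M.Record => (ω k).1 := measurable_fst.comp (measurable_pi_apply k)
  have hprob (ν : Measure M.questions) [IsFiniteMeasure ν] :
      Integrable (logLik p u) (ν ⊗ₘ M.response p) :=
    Integrable.of_bound hm.aestronglyMeasurable C (ae_of_all _ hC)
  rw [← integral_map (φ := fun ω : M.Record => ω k) (f := logLik p u)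
    (measurable_pi_apply k).aemeasurable hm.aestronglyMeasurable, A.map_eval_restrict_law p k hS,
    Measure.integral_compProd (hprob _)]
  simp_rw [integral_logLik]
  rw [integral_map hfst.aemeasurable]
  · rfl
  · simp_rw [← integral_logLik]
    exact (hm.stronglyMeasurable.integral_kernel_prod_right'
      (κ := M.response p)).aestronglyMeasurable

/-- Change of measure: up to time `n`, the law at ability `u` has density
`exp (-∑_{k < n} logLik p u)` with respect to the law at ability `p`. -/
lemma lintegral_law_change (p u : M.Ability) (n : ℕ) {f : M.Record → ℝ≥0∞}
    (hf : Measurable[M.history n] f) :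
    ∫⁻ ω, f ω ∂A.law u = ∫⁻ ω, f ω *
      ENNReal.ofReal (Real.exp (-∑ k ∈ Finset.range n, logLik p u (ω k))) ∂A.law p := by
  induction n generalizing f with
  | zero =>
    rw [history_zero] at hf
    obtain ⟨c, rfl⟩ := eq_const_of_measurable_bot hf
    simp
  | succ n ih =>
    have hZ (k : ℕ) : Measurable[M.history k] fun ω : M.Record =>
        ENNReal.ofReal (Real.exp (-∑ k ∈ Finset.range k, logLik p u (ω k))) := by
      refine (Real.measurable_exp.comp (Measurable.neg ?_)).ennreal_ofReal
      exact Finset.measurable_sum _ fun i hi =>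
        (measurable_logLik p u).comp (M.measurable_eval (Finset.mem_range.1 hi))
    have hρ : Measurable fun o : M.Obs => ENNReal.ofReal (Real.exp (-logLik p u o)) :=
      (Real.measurable_exp.comp (measurable_logLik p u).neg).ennreal_ofReal
    have hle := M.history.le
    set ν := (A.law p).withDensity fun ω =>
      ENNReal.ofReal (Real.exp (-∑ k ∈ Finset.range (n + 1), logLik p u (ω k))) with hν
    have hset : ∀ E, MeasurableSet[M.history (n + 1)] E → A.law u E = ν E := by
      intro E hE
      rw [history_succ, ← @MeasurableSpace.comap_id _ (M.history n)] at hE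
      refine @measure_eq_of_forall_inter _ _ _ _ (M.history n) _ (A.law u) ν _ id (fun ω => ω n)
        (measurable_id'' (hle n)) (measurable_pi_apply n) (fun S T hS hT => ?_) E hE
      have hS' := hle n _ hS
      have hT' : MeasurableSet ((fun ω : M.Record => ω n) ⁻¹' T) := measurable_pi_apply n hT
      have hindS : Measurable[M.history n] (S.indicator (1 : M.Record → ℝ≥0∞)) :=
        measurable_indicator_one hS
      have hindT : Measurable (T.indicator (1 : M.Obs → ℝ≥0∞)) := measurable_one.indicator hT
      have hmul (ω : M.Record) : (S ∩ (fun ω : M.Record => ω n) ⁻¹' T).indicator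
          (1 : M.Record → ℝ≥0∞) ω = S.indicator 1 ω * T.indicator 1 (ω n) := by
        by_cases h1 : ω ∈ S <;> by_cases h2 : ω n ∈ T <;> simp [h1, h2]
      rw [Set.preimage_id, ← lintegral_indicator_one (hS'.inter hT'),
        ← lintegral_indicator_one (hS'.inter hT')]
      simp_rw [hmul]
      rw [A.lintegral_mul_eval u n hindS hindT, ih]
      · simp_rw [lintegral_response_change p u]
        have hB := A.lintegral_mul_eval p n (hindS.mul (hZ n)) (hρ.mul hindT)
        simp only [Pi.mul_apply] at hB
        have hST : Measurable fun ω : M.Record =>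
            S.indicator (1 : M.Record → ℝ≥0∞) ω * T.indicator (1 : M.Obs → ℝ≥0∞) (ω n) :=
          (hindS.mono (hle n) le_rfl).mul (hindT.comp (measurable_pi_apply n))
        rw [hν, lintegral_withDensity_eq_lintegral_mul _ ((hZ (n + 1)).mono (hle _) le_rfl) hST]
        refine Eq.trans (lintegral_congr fun ω => ?_) (hB.symm.trans (lintegral_congr fun ω => ?_))
        · ring
        · simp only [Pi.mul_apply, Finset.sum_range_succ, neg_add, Real.exp_add,
            ENNReal.ofReal_mul (Real.exp_pos _).le]
          ring
      · exact hindS.mul (A.measurable_lintegral_nextQuestion n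
          (measurable_lintegral_response u hindT))
    have htrim : (A.law u).trim (hle (n + 1)) = ν.trim (hle (n + 1)) := by
      refine @Measure.ext _ (M.history (n + 1)) _ _ fun E hE => ?_
      rw [trim_measurableSet_eq _ hE, trim_measurableSet_eq _ hE, hset E hE]
    rw [← lintegral_trim (hle (n + 1)) hf, htrim, lintegral_trim (hle (n + 1)) hf, hν,
      lintegral_withDensity_eq_lintegral_mul _ ((hZ (n + 1)).mono (hle _) le_rfl)
        (hf.mono (hle _) le_rfl)]
    simp_rw [Pi.mul_apply, mul_comm]

end QuestionRule

/-! ### Stopping times with finite mean -/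

section StoppingTime

variable {Ω : Type*} {mΩ : MeasurableSpace Ω} {μ : Measure Ω} {ℱ : Filtration ℕ mΩ} {τ : Ω → ℕ∞}

lemma measurableSet_eq_natCast (hτ : IsStoppingTime ℱ τ) (n : ℕ) :
    MeasurableSet[ℱ n] {ω | τ ω = n} := hτ.measurableSet_eq n

lemma measurableSet_natCast_lt (hτ : IsStoppingTime ℱ τ) (n : ℕ) :
    MeasurableSet[ℱ n] {ω | n < τ ω} := hτ.measurableSet_gt n

lemma measurableSet_eq_top (hτ : IsStoppingTime ℱ τ) : MeasurableSet {ω | τ ω = ⊤} := by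
  have : {ω | τ ω = ⊤} = (⋃ n : ℕ, {ω | τ ω = n})ᶜ := by
    ext ω
    simp only [Set.mem_ofPred_eq, Set.mem_compl_iff, Set.mem_iUnion, not_exists]
    exact ⟨fun h n => by simp [h], fun h => by
      by_contra h'
      obtain ⟨n, hn⟩ := ENat.ne_top_iff_exists.1 h'
      exact h n hn.symm⟩
  rw [this]
  exact (MeasurableSet.iUnion fun n => ℱ.le n _ (measurableSet_eq_natCast hτ n)).compl

lemma measurable_toNat (hτ : IsStoppingTime ℱ τ) : Measurable fun ω => (τ ω).toNat := by
  refine measurable_to_countable' fun n => ?_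
  have : (fun ω => (τ ω).toNat) ⁻¹' {n} = {ω | τ ω = n} ∪ ({ω | τ ω = ⊤} ∩ {_ω | n = 0}) := by
    ext ω
    simp only [Set.mem_preimage, Set.mem_singleton_iff, Set.mem_union, Set.mem_ofPred_eq,
      Set.mem_inter_iff]
    cases τ ω <;> simp [eq_comm]
  rw [this]
  exact (ℱ.le n _ (measurableSet_eq_natCast hτ n)).union
    ((measurableSet_eq_top hτ).inter (MeasurableSet.const _))

lemma ae_ne_top_of_lintegral_lt_top (hτ : IsStoppingTime ℱ τ)
    (hfin : ∫⁻ ω, (τ ω : ℝ≥0∞) ∂μ < ∞) : ∀ᵐ ω ∂μ, τ ω ≠ ⊤ := by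
  have h1 : ∫⁻ ω, {ω | τ ω = ⊤}.indicator (fun _ => ∞) ω ∂μ ≤ ∫⁻ ω, (τ ω : ℝ≥0∞) ∂μ := by
    refine lintegral_mono fun ω => ?_
    by_cases h : τ ω = ⊤ <;> simp [h]
  rw [lintegral_indicator_const (measurableSet_eq_top hτ)] at h1
  have h2 : μ {ω | τ ω = ⊤} = 0 := by
    by_contra h
    rw [ENNReal.top_mul h] at h1
    exact (h1.trans_lt hfin).ne rfl
  rw [ae_iff]
  simpa using h2

lemma lintegral_toNat_lt_top (hfin : ∫⁻ ω, (τ ω : ℝ≥0∞) ∂μ < ∞) :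
    ∫⁻ ω, ((τ ω).toNat : ℝ≥0∞) ∂μ < ∞ := by
  refine (lintegral_mono fun ω => ?_).trans_lt hfin
  cases τ ω <;> simp

/-- For an almost surely finite stopping time the event `k < τ.toNat` is, up to a null set, the
event `k < τ`, which is known at time `k`. -/
lemma restrict_lt_toNat (hfin : ∀ᵐ ω ∂μ, τ ω ≠ ⊤) (k : ℕ) :
    μ.restrict {ω | k < (τ ω).toNat} = μ.restrict {ω | k < τ ω} := by
  refine Measure.restrict_congr_set ?_
  rw [Filter.eventuallyEq_set]
  filter_upwards [hfin] with ω hω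
  obtain ⟨n, hn⟩ := ENat.ne_top_iff_exists.1 hω
  simp [← hn]

end StoppingTime

/-! ### Stopped likelihood ratio and occupation measure -/

namespace QuestionRule

open ResponseModel

variable {M : ResponseModel} (A : QuestionRule M)

/-- `m_τ(x) = ∑ₖ P(k < τ, Xₖ ≤ x)`: the event `k < τ` belongs to the history before the question of
index `k`, so that on it the conditional probability can be replaced by the event itself. -/
lemma condSampling_integrable_and_hasSum (p : M.Ability) {τ : M.Record → ℕ∞}
    (hτ : IsStoppingTime M.history τ) (hfin : ∫⁻ ω, (τ ω : ℝ≥0∞) ∂A.law p < ∞) (x : ℝ) :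
    Integrable (A.condSampling p τ x) (A.law p) ∧
    HasSum (fun k => (A.law p).real ({ω | M.question k ω ≤ x} ∩ {ω | k < (τ ω).toNat}))
      (A.samplingDF p τ x) := by
  have hq (k : ℕ) : MeasurableSet {ω : M.Record | M.question k ω ≤ x} :=
    measurableSet_le (measurable_subtype_coe.comp (measurable_eval_fst k))
      measurable_const
  have hYm (k : ℕ) : AEStronglyMeasurable
      ((A.law p)⟦{ω' | M.question k ω' ≤ x} | M.history k⟧) (A.law p) :=
    integrable_condExp.aestronglyMeasurable
  have hYb (k : ℕ) : ∀ᵐ ω ∂A.law p,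
      |((A.law p)⟦{ω' | M.question k ω' ≤ x} | M.history k⟧) ω| ≤ 1 := by
    refine ae_bdd_abs_condExp_of_ae_bdd_abs (ae_of_all _ fun ω => ?_)
    by_cases h : ω ∈ {ω' | M.question k ω' ≤ x} <;> simp [h]
  have hN := measurable_toNat hτ
  have hNfin := lintegral_toNat_lt_top hfin
  refine ⟨integrable_sum_range hN hNfin hYm hYb, ?_⟩
  refine (hasSum_setIntegral_sum_range hN hNfin hYm hYb).congr_fun fun k => ?_
  rw [measureReal_def, ← Measure.restrict_apply (hq k),
    restrict_lt_toNat (ae_ne_top_of_lintegral_lt_top hτ hfin),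
    setIntegral_condExp (M.history.le k) ((integrable_const _).indicator (hq k))
      (measurableSet_natCast_lt hτ k), integral_indicator_const _ (hq k)]
  simp [measureReal_def]

/-- Change of measure at a stopping time which is almost surely finite at ability `p`. It is only an
inequality, as `τ = ⊤` may have positive probability at ability `u`. -/
lemma setLIntegral_exp_neg_le (p u : M.Ability) {τ : M.Record → ℕ∞}
    (hτ : IsStoppingTime M.history τ) (hfin : ∀ᵐ ω ∂A.law p, τ ω ≠ ⊤) {E : Set M.Record}
    (hE : MeasurableSet[hτ.measurableSpace] E) :
    ∫⁻ ω in E, ENNReal.ofReal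
      (Real.exp (-∑ k ∈ Finset.range (τ ω).toNat, logLik p u (ω k))) ∂A.law p ≤ A.law u E := by
  have hEn (n : ℕ) : MeasurableSet[M.history n] (E ∩ {ω | τ ω = n}) :=
    (hτ.measurableSet_inter_eq_iff E n).1 (hE.inter (hτ.measurableSet_eq_of_countable' n))
  have hEn' (n : ℕ) := M.history.le n _ (hEn n)
  have hdisj : Pairwise (Function.onFun Disjoint fun n : ℕ => E ∩ {ω | τ ω = n}) := by
    intro i j hij
    refine Set.disjoint_left.2 fun ω hi hj => hij ?_
    exact Nat.cast_injective (hi.2.symm.trans hj.2)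
  have hae : E =ᵐ[A.law p] ⋃ n : ℕ, E ∩ {ω | τ ω = n} := by
    rw [Filter.eventuallyEq_set]
    filter_upwards [hfin] with ω hω
    obtain ⟨n, hn⟩ := ENat.ne_top_iff_exists.1 hω
    simp [← hn]
  rw [Measure.restrict_congr_set hae, lintegral_iUnion hEn' hdisj]
  calc _ = ∑' n : ℕ, A.law u (E ∩ {ω | τ ω = n}) := by
        congr with n
        rw [← lintegral_indicator_one (hEn' n),
          A.lintegral_law_change p u n (measurable_indicator_one (hEn n)),
          ← lintegral_indicator (hEn' n)]
        congr with ω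
        by_cases h : ω ∈ E ∩ {ω | τ ω = n}
        · have h2 : τ ω = n := h.2
          simp [Set.indicator_of_mem h, h2]
        · simp [Set.indicator_of_notMem h]
    _ = A.law u (⋃ n : ℕ, E ∩ {ω | τ ω = n}) := (measure_iUnion hdisj hEn').symm
    _ ≤ A.law u E := measure_mono (Set.iUnion_subset fun n => Set.inter_subset_left)

/-- The expected number of times a question in a given set is asked up to `τ`, as a measure on the
set of questions. Records with `τ = ⊤`, where `τ.toNat = 0`, do not contribute. -/
noncomputable def occupation (p : M.Ability) (τ : M.Record → ℕ∞) : Measure M.questions :=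
  Measure.sum fun k => ((A.law p).restrict {ω | k < (τ ω).toNat}).map fun ω => (ω k).1

lemma isFiniteMeasure_occupation (p : M.Ability) {τ : M.Record → ℕ∞}
    (hτ : IsStoppingTime M.history τ) (hfin : ∫⁻ ω, (τ ω : ℝ≥0∞) ∂A.law p < ∞) :
    IsFiniteMeasure (A.occupation p τ) := by
  refine ⟨?_⟩
  rw [occupation, Measure.sum_apply _ .univ]
  simp_rw [Measure.map_apply (measurable_eval_fst _) .univ, Set.preimage_univ,
    Measure.restrict_apply_univ]
  rw [tsum_measure_lt (measurable_toNat hτ)]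
  exact lintegral_toNat_lt_top hfin

/-- The distribution function of the occupation measure is the expected conditional-sampling
distribution function `m_τ`. -/
lemma occupation_map_real_Iic (p : M.Ability) {τ : M.Record → ℕ∞}
    (hτ : IsStoppingTime M.history τ) (hfin : ∫⁻ ω, (τ ω : ℝ≥0∞) ∂A.law p < ∞) (x : ℝ) :
    ((A.occupation p τ).map Subtype.val).real (Set.Iic x) = A.samplingDF p τ x := by
  rw [← (A.condSampling_integrable_and_hasSum p hτ hfin x).2.tsum_eq, measureReal_def,
    Measure.map_apply measurable_subtype_coe measurableSet_Iic, occupation,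
    Measure.sum_apply _ (measurable_subtype_coe measurableSet_Iic), ENNReal.tsum_toReal_eq]
  · congr with k
    rw [Measure.map_apply (measurable_eval_fst k)
      (measurable_subtype_coe measurableSet_Iic), Measure.restrict_apply]
    · rfl
    · exact (measurable_eval_fst k) (measurable_subtype_coe measurableSet_Iic)
  · exact fun k => measure_ne_top _ _

end QuestionRule

end AdaptiveTest

/-! ### Equality and lower bound for the expected divergence -/

open AdaptiveTest AdaptiveTest.ResponseModel

theorem mainTheorem5 (M : AdaptiveTest.ResponseModel) (A : AdaptiveTest.QuestionRule M)
    (p u : M.Ability) (τ : M.Record → ℕ∞)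
    (hτ : IsStoppingTime M.history τ)
    (hτ_fin : ∫⁻ ω, (τ ω : ℝ≥0∞) ∂(A.law p) < ∞) :
    Integrable (fun ω => ∑ k ∈ Finset.range (τ ω).toNat,
      AdaptiveTest.d (M.h (M.question k ω) p) (M.h (M.question k ω) u)) (A.law p) ∧
    (∀ x : ℝ, Integrable (A.condSampling p τ x) (A.law p)) ∧
    ∃ m : StieltjesFunction ℝ, (∀ x : ℝ, m x = A.samplingDF p τ x) ∧
      IntegrableOn (fun x => AdaptiveTest.d (M.h x p) (M.h x u)) M.questions m.measure ∧
      ∫ ω, ∑ k ∈ Finset.range (τ ω).toNat,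
          AdaptiveTest.d (M.h (M.question k ω) p) (M.h (M.question k ω) u) ∂(A.law p)
        = ∫ x in M.questions, AdaptiveTest.d (M.h x p) (M.h x u) ∂m.measure ∧
      ⨆ E : {E : Set M.Record // MeasurableSet[hτ.measurableSpace] E},
          AdaptiveTest.dExt ((A.law p).real E) ((A.law u).real E)
        ≤ ((∫ x in M.questions, AdaptiveTest.d (M.h x p) (M.h x u) ∂m.measure : ℝ) : EReal) := by
  have hN := measurable_toNat hτ
  have hNfin := lintegral_toNat_lt_top hτ_fin
  have htop := ae_ne_top_of_lintegral_lt_top hτ hτ_fin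
  have hν := A.isFiniteMeasure_occupation p hτ hτ_fin
  obtain ⟨C, hC⟩ := exists_abs_d_le p u
  obtain ⟨B, hB⟩ := exists_abs_logLik_le p u
  have hdm (k : ℕ) : AEStronglyMeasurable (fun ω : M.Record =>
      d (M.h (M.question k ω) p) (M.h (M.question k ω) u)) (A.law p) :=
    ((measurable_d p u).comp (measurable_eval_fst k)).aestronglyMeasurable
  have hdb (k : ℕ) : ∀ᵐ ω ∂A.law p, |d (M.h (M.question k ω) p) (M.h (M.question k ω) u)| ≤ C :=
    ae_of_all _ fun ω => hC (ω k).1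
  have hlm (k : ℕ) : AEStronglyMeasurable (fun ω : M.Record => logLik p u (ω k)) (A.law p) :=
    ((measurable_logLik p u).comp (measurable_pi_apply k)).aestronglyMeasurable
  have hlb (k : ℕ) : ∀ᵐ ω ∂A.law p, |logLik p u (ω k)| ≤ B := ae_of_all _ fun ω => hB (ω k)
  -- Wald's identity, for the divergences and for the log-likelihood ratios: the terms of the two
  -- series are equal because `k < τ` is known before the question of index `k` is asked.
  have hd_sum := hasSum_setIntegral_sum_range hN hNfin hdm hdb
  have hl_sum := hasSum_setIntegral_sum_range hN hNfin hlm hlb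
  have hemb : MeasurableEmbedding (Subtype.val : M.questions → ℝ) :=
    MeasurableEmbedding.subtype_coe M.isCompact_questions.measurableSet
  have hd_int : Integrable (fun x : M.questions => d (M.h x p) (M.h x u)) (A.occupation p τ) :=
    Integrable.of_bound (measurable_d p u).aestronglyMeasurable C (ae_of_all _ hC)
  obtain ⟨m, hm, hmν⟩ := exists_stieltjesFunction_measure_eq ((A.occupation p τ).map Subtype.val)
  have hint : ∫ ω, ∑ k ∈ Finset.range (τ ω).toNat,
      d (M.h (M.question k ω) p) (M.h (M.question k ω) u) ∂(A.law p) =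
        ∫ x in M.questions, d (M.h x p) (M.h x u) ∂m.measure := by
    rw [hmν, hemb.setIntegral_map, Subtype.coe_preimage_self, Measure.restrict_univ]
    refine hd_sum.unique ((hasSum_integral_measure hd_int).congr_fun fun k => ?_)
    rw [integral_map (measurable_eval_fst k).aemeasurable (measurable_d p u).aestronglyMeasurable]
    rfl
  refine ⟨integrable_sum_range hN hNfin hdm hdb,
    fun x => (A.condSampling_integrable_and_hasSum p hτ hτ_fin x).1, m,
    fun x => (hm x).trans (A.occupation_map_real_Iic p hτ hτ_fin x), ?_, hint,
    iSup_le fun E => ?_⟩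
  · rw [hmν, hemb.integrableOn_map_iff]
    exact hd_int.integrableOn
  · have hWald : ∫ ω, ∑ k ∈ Finset.range (τ ω).toNat, logLik p u (ω k) ∂A.law p =
        ∫ x in M.questions, d (M.h x p) (M.h x u) ∂m.measure := by
      rw [← hint]
      refine hl_sum.unique (hd_sum.congr_fun fun k => ?_)
      rw [restrict_lt_toNat htop, A.setIntegral_logLik p u k (measurableSet_natCast_lt hτ k)]
    rw [← hWald]
    exact dExt_le_integral (integrable_sum_range hN hNfin hlm hlb) (hτ.measurableSpace_le _ E.2)
      (A.setLIntegral_exp_neg_le p u hτ htop E.2) (A.setLIntegral_exp_neg_le p u hτ htop E.2.compl)
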